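/- Let $I$ (nodes), $\mathcal T$ (relief items) and $L$ (disaster levels) be finite sets and let $\mathcal A\subseteq I\times I$ be a set of arcs. Let $S_i,s_t,c^p_t,c^u_t,c^h_t,c^t_{i,j}\ge 0$ and $v_t,\hat V_{i,j}\in\mathbb R$ be given. A first-stage decision $(o,z)$ is feasible if $o_i\in\{0,1\}$, $z_{t,i}\ge 0$ and $\sum_{t}s_tz_{t,i}\le S_io_i$ for all $i\in I$, $t\in\mathcal T$. For $\xi=(q,d,\rho,M,V)$ let $Q(o,z,\xi)$ be the minimum of $$\sum_{i\in I}\sum_{t\in\mathcal T}\big(c^p_ty_{t,i}+c^u_tu_{t,i}+c^h_te_{t,i}\big)+\sum_{t\in\mathcal T}\sum_{(i,j)\in\mathcal A}c^t_{i,j}x^t_{i,j}$$ over $y,u,e,x\ge 0$ subject to $$\sum_{j:(j,i)\in\mathcal A}x^t_{j,i}-\sum_{j:(i,j)\in\mathcal A}x^t_{i,j}+y_{t,i}-e_{t,i}+u_{t,i}=\sum_{l\in L}q_{i,l}\big(d_{t,i,l}-\rho_{i,l}z_{t,i}\big)-\Big(1-\sum_{l\in L}q_{i,l}\Big)z_{t,i},\qquad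 y_{t,i}\le\sum_{l\in L}q_{i,l}M_{t,i,l}$$ for all $t\in\mathcal T$, $i\in I$, and $$\sum_{t\in\mathcal T} v_tx^t_{i,j}\le\sum_{l\in L}q_{k,l}V_{i,j,l}+\Big(1-\sum_{l\in L}q_{k,l}\Big)\hat V_{i,j},\qquad k\in\{i,j\},\ (i,j)\in\mathcal A.$$ Let $\mathcal R=\mathcal R^q\times\mathcal R^d\times\mathcal R^\rho\times\mathcal R^M\times\mathcal R^V$, where $\mathcal R^q\subseteq\{0,1\}^{I\times L}$ is any set of disaster patterns (for instance the whole of $\{0,1\}^{I\times L}$) and $\mathcal R^d=\{d\ge 0:\underline d\le d\le\overline d\}$, and $\mathcal R^\rho,\mathcal R^M,\mathcal R^V$ are boxes of the same form. Assume relatively complete recourse: the problem defining $Q(o,z,\xi)$ is feasible for every feasible $(o,z)$ and every $\xi\in\mathcal R$. Let $\mathcal F(\mathcal R,\mu)$ be the set of Borel probability measures $\mathbb P$ on $\mathcal R$ with $\mathbb E_{\mathbb P}[\xi]=\mu$, where $\mu=(\mu^q,\mu^d,\mu^\rho,\mu^M,\mu^V)$ is such that $\mathcal F(\mathcal R,\mu)\neq\emptyset$.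 For real multipliers $m=(\alpha,\phi,\gamma,\lambda,\tau)$ put $$\langle m,\xi\rangle=\sum_{l\in L}\Big[\sum_{i\in I}\sum_{t\in\mathcal T}\big(d_{t,i,l}\alpha_{t,i,l}+M_{t,i,l}\phi_{t,i,l}\big)+\sum_{i\in I}\big(\rho_{i,l}\gamma_{i,l}+q_{i,l}\lambda_{i,l}\big)+\sum_{(i,j)\in\mathcal A}V_{i,j,l}\tau_{i,j,l}\Big].$$ **Proposition.** For every feasible $(o,z)$, the function $Q(o,z,\cdot)$ is integrable under every $\mathbb P\in\mathcal F(\mathcal R,\mu)$, and $$\sup_{\mathbb P\in\mathcal F(\mathcal R,\mu)}\mathbb E_{\mathbb P}\big[Q(o,z,\xi)\big]=\min_{\alpha,\phi,\gamma,\lambda,\tau}\Big\{\langle m,\mu\rangle+\max_{\xi\in\mathcal R}\big\{Q(o,z,\xi)-\langle m,\xi\rangle\big\}\Big\},$$ where the supremum is finite, the inner maximum is attained for every $m$, and the outer minimum is attained. -/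

import Mathlib

open MeasureTheory

noncomputable section

/-- Deterministic data of the two-stage prepositioning problem: `I` is the set of nodes
(candidate sites and demand nodes), `T` the set of relief items, `L` the set of disaster levels,
`A` the set of arcs of the directed graph on `I`. -/
structure ReliefData (I T L : Type*) (A : Finset (I × I)) where
  /-- storage capacity `S_i` -/
  S : I → ℝ
  /-- storage space `s_t` per unit of item `t` -/
  s : T → ℝ
  /-- post-disaster unit procurement cost `c_t^p` -/
  cp : T → ℝ
  /-- unit penalty cost of unmet demand `c_t^u` -/
  cu : T → ℝ
  /-- unit holding cost `c_t^h` -/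
  ch : T → ℝ
  /-- unit transportation cost `c_{i,j}^t` -/
  ct : A → T → ℝ
  /-- arc capacity `v_t` required to ship one unit of item `t` -/
  v : T → ℝ
  /-- nominal capacity of the arc `(i,j)` -/
  Vhat : A → ℝ
  S_nonneg : ∀ i, 0 ≤ S i
  s_nonneg : ∀ t, 0 ≤ s t
  cp_nonneg : ∀ t, 0 ≤ cp t
  cu_nonneg : ∀ t, 0 ≤ cu t
  ch_nonneg : ∀ t, 0 ≤ ch t
  ct_nonneg : ∀ a t, 0 ≤ ct a t

/-- The space of the uncertain parameters `ξ = (q, d, ρ, M, V)`, a finite-dimensional real vector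
space; its measurable structure is the Borel one. -/
abbrev Scenario (I T L : Type*) (A : Finset (I × I)) : Type _ :=
  (I → L → ℝ) × (T → I → L → ℝ) × (I → L → ℝ) × (T → I → L → ℝ) × (A → L → ℝ)

namespace Scenario

variable {I T L : Type*} {A : Finset (I × I)}

/-- disaster indicators `q_{i,l}` -/
def q (ξ : Scenario I T L A) : I → L → ℝ := ξ.1

/-- demands `d_{t,i,l}` -/
def d (ξ : Scenario I T L A) : T → I → L → ℝ := ξ.2.1

/-- usable fractions `ρ_{i,l}` -/
def rho (ξ : Scenario I T L A) : I → L → ℝ := ξ.2.2.1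

/-- maximal post-disaster order quantities `M_{t,i,l}` -/
def M (ξ : Scenario I T L A) : T → I → L → ℝ := ξ.2.2.2.1

/-- arc capacities `V_{i,j,l}` -/
def V (ξ : Scenario I T L A) : A → L → ℝ := ξ.2.2.2.2

end Scenario

/-- Data of the support: lower and upper bounds of `d, ρ, M, V` (the `q`-components of `lo` and
`hi` are not used), and side constraints `qSide` on the disaster pattern `q`, such as at most one
disaster per node or a prescribed number of disasters of each level.
`qSide = Set.univ` means that there are none. -/
structure SupportData (I T L : Type*) (A : Finset (I × I)) where
  lo : Scenario I T L A
  hi : Scenario I T L A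
  qSide : Set (I → L → ℝ)

/-- The support `R = R^q × R^d × R^ρ × R^M × R^V`; if `qSide` is everything then `R^q` is the set
of all 0-1 vectors. -/
def SupportData.R {I T L : Type*} {A : Finset (I × I)} (B : SupportData I T L A) :
    Set (Scenario I T L A) :=
  {ξ | ((∀ i l, ξ.q i l = 0 ∨ ξ.q i l = 1) ∧ ξ.q ∈ B.qSide) ∧
    (∀ t i l, 0 ≤ ξ.d t i l ∧ B.lo.d t i l ≤ ξ.d t i l ∧ ξ.d t i l ≤ B.hi.d t i l) ∧
    (∀ i l, 0 ≤ ξ.rho i l ∧ B.lo.rho i l ≤ ξ.rho i l ∧ ξ.rho i l ≤ B.hi.rho i l) ∧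
    (∀ t i l, 0 ≤ ξ.M t i l ∧ B.lo.M t i l ≤ ξ.M t i l ∧ ξ.M t i l ≤ B.hi.M t i l) ∧
    (∀ a l, 0 ≤ ξ.V a l ∧ B.lo.V a l ≤ ξ.V a l ∧ ξ.V a l ≤ B.hi.V a l)}

/-- A first-stage decision: opened facilities `o` and prepositioned amounts `z`. -/
structure FirstStage (I T : Type*) where
  o : I → ℝ
  z : T → I → ℝ

/-- A second-stage decision: procurement `y`, unmet demand `u`, unused inventory `e`, flows `x`. -/
structure Recourse (I T : Type*) (A : Finset (I × I)) where
  y : T → I → ℝ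
  u : T → I → ℝ
  e : T → I → ℝ
  x : A → T → ℝ

/-- Dual multipliers `(α, φ, γ, λ, τ)`, unrestricted in sign. -/
structure Multipliers (I T L : Type*) (A : Finset (I × I)) where
  alpha : T → I → L → ℝ
  phi : T → I → L → ℝ
  gamma : I → L → ℝ
  lam : I → L → ℝ
  tau : A → L → ℝ

section Model

variable {I T L : Type*} [Fintype I] [DecidableEq I] [Fintype T] [Fintype L]
  {A : Finset (I × I)}

/-- The first-stage constraints. -/
def ReliefData.FirstStageFeasible (D : ReliefData I T L A) (w : FirstStage I T) : Prop :=
  (∀ i, ∑ t, D.s t * w.z t i ≤ D.S i * w.o i) ∧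
    (∀ i, w.o i = 0 ∨ w.o i = 1) ∧ ∀ t i, 0 ≤ w.z t i

/-- The capacity of arc `a` as determined by the disasters at the node `k` (one of its ends):
`∑_l q_{k,l} V_{a,l} + (1 - ∑_l q_{k,l}) V̂_a`. -/
def ReliefData.arcCap (D : ReliefData I T L A) (ξ : Scenario I T L A) (a : A) (k : I) : ℝ :=
  ∑ l, ξ.q k l * ξ.V a l + (1 - ∑ l, ξ.q k l) * D.Vhat a

/-- The constraints of the recourse problem. -/
def ReliefData.RecourseFeasible (D : ReliefData I T L A) (w : FirstStage I T)
    (ξ : Scenario I T L A) (r : Recourse I T A) : Prop :=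
  (∀ t i, ∑ a : A with a.1.2 = i, r.x a t - ∑ a : A with a.1.1 = i, r.x a t
      + r.y t i - r.e t i + r.u t i
      = ∑ l, ξ.q i l * (ξ.d t i l - ξ.rho i l * w.z t i) - (1 - ∑ l, ξ.q i l) * w.z t i) ∧
  (∀ t i, r.y t i ≤ ∑ l, ξ.q i l * ξ.M t i l) ∧
  (∀ a : A, ∑ t, D.v t * r.x a t ≤ D.arcCap ξ a a.1.1) ∧
  (∀ a : A, ∑ t, D.v t * r.x a t ≤ D.arcCap ξ a a.1.2) ∧
  (∀ t i, 0 ≤ r.y t i) ∧ (∀ t i, 0 ≤ r.e t i) ∧ (∀ t i, 0 ≤ r.u t i) ∧ (∀ a t, 0 ≤ r.x a t)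

/-- The objective of the recourse problem. -/
def ReliefData.recourseCost (D : ReliefData I T L A) (r : Recourse I T A) : ℝ :=
  ∑ i, ∑ t, (D.cp t * r.y t i + D.cu t * r.u t i + D.ch t * r.e t i)
    + ∑ t, ∑ a, D.ct a t * r.x a t

/-- The recourse value `Q(o, z, ξ)`. The costs of feasible decisions are bounded below by `0`, so
this is the true infimum as soon as the recourse problem is feasible. -/
def ReliefData.Q (D : ReliefData I T L A) (w : FirstStage I T) (ξ : Scenario I T L A) : ℝ :=
  sInf (D.recourseCost '' {r | D.RecourseFeasible w ξ r})

/-- Relatively complete recourse: the recourse problem is feasible for every feasible first-stage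
decision and every realization in the support. -/
def ReliefData.RelativelyCompleteRecourse (D : ReliefData I T L A) (B : SupportData I T L A) :
    Prop :=
  ∀ w, D.FirstStageFeasible w → ∀ ξ ∈ B.R, ∃ r, D.RecourseFeasible w ξ r

/-- The mean-support ambiguity set `F(R, μ)`: Borel probability measures carried by `R` with
`E[ξ] = μ`. (The components of `ξ` are bounded on `R`, hence integrable.) -/
def SupportData.ambiguitySet (B : SupportData I T L A) (μ : Scenario I T L A) :
    Set (Measure (Scenario I T L A)) :=
  {P | IsProbabilityMeasure P ∧ P B.Rᶜ = 0 ∧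
    (∀ i l, ∫ ξ, ξ.q i l ∂P = μ.q i l) ∧
    (∀ t i l, ∫ ξ, ξ.d t i l ∂P = μ.d t i l) ∧
    (∀ i l, ∫ ξ, ξ.rho i l ∂P = μ.rho i l) ∧
    (∀ t i l, ∫ ξ, ξ.M t i l ∂P = μ.M t i l) ∧
    (∀ a l, ∫ ξ, ξ.V a l ∂P = μ.V a l)}

/-- The multiplier-weighted value of `ξ`. -/
def Multipliers.pairing (m : Multipliers I T L A) (ξ : Scenario I T L A) : ℝ :=
  ∑ l, (∑ i, ∑ t, (ξ.d t i l * m.alpha t i l + ξ.M t i l * m.phi t i l)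
    + ∑ i, (ξ.rho i l * m.gamma i l + ξ.q i l * m.lam i l)
    + ∑ a, ξ.V a l * m.tau a l)

/-- The inner maximand `Q(o, z, ξ) - ⟨m, ξ⟩` of the dual problem. -/
def ReliefData.innerObj (D : ReliefData I T L A) (w : FirstStage I T)
    (m : Multipliers I T L A) (ξ : Scenario I T L A) : ℝ :=
  D.Q w ξ - m.pairing ξ

/-- The dual objective `⟨m, μ⟩ + max_{ξ ∈ R} (Q(o, z, ξ) - ⟨m, ξ⟩)`. -/
def ReliefData.dualObj (D : ReliefData I T L A) (B : SupportData I T L A)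
    (μ : Scenario I T L A) (w : FirstStage I T) (m : Multipliers I T L A) : ℝ :=
  m.pairing μ + sSup (D.innerObj w m '' B.R)

end Model

end

noncomputable section

/-! Once the disaster pattern `q` is fixed, the right-hand sides of the recourse constraints are
affine in `(d, ρ, M, V)`, so `Q` is convex on the corresponding box (`convexOn_Q`). A convex
function minus a linear one is dominated on a box by its values at the vertices. There are finitely
many patterns, hence finitely many vertices in all, and for every `m` the function `Q - ⟨m, ·⟩` is
dominated on the support by its values there (`exists_corner_ge`). This makes the inner maximum
attained.

The moment problem thereby reduces to a finite linear program: choose weights on the vertices with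
mean `μ` so as to maximize the average of `Q`. It is feasible because the mean of a law on the
support lies in the closed convex hull of the vertices. Its strong duality
(`exists_weights_and_affine_majorant`, from Farkas' lemma) yields optimal weights and an affine
majorant of `Q` at the vertices with no larger value at `μ`. The majorant extends to the whole
support by vertex domination, and its linear part gives the multipliers. Integrating affine
majorants gives the converse inequality for every law.

Integrability is a separate matter: `Q` is bounded, and measurable because a bounded convex function
on a box is upper semicontinuous. -/

open Filter Set Topology

/-! ### Farkas' lemma and finite linear programming duality. -/

/-- **Farkas' lemma** for finitely many linear functionals. -/
theorem farkas_finset {ι W : Type*} [AddCommGroup W] [Module ℝ W] (s : Finset ι) :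
    ∀ (φ : ι → W →ₗ[ℝ] ℝ) (ψ : W →ₗ[ℝ] ℝ), (∀ w, (∀ i ∈ s, 0 ≤ φ i w) → 0 ≤ ψ w) →
      ∃ c : ι → ℝ, (∀ i ∈ s, 0 ≤ c i) ∧ ψ = ∑ i ∈ s, c i • φ i := by
  classical
  induction s using Finset.induction_on with
  | empty =>
    intro φ ψ h
    refine ⟨0, by simp, LinearMap.ext fun w => ?_⟩
    have h₁ := h w (by simp)
    have h₂ := h (-w) (by simp)
    rw [map_neg] at h₂
    simp only [Finset.sum_empty, LinearMap.zero_apply]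
    linarith
  | insert j s hj ih =>
    intro φ ψ h
    by_cases hs : ∀ w, (∀ i ∈ s, 0 ≤ φ i w) → 0 ≤ ψ w
    · obtain ⟨c, hc, hψ⟩ := ih φ ψ hs
      refine ⟨Function.update c j 0, fun i hi => ?_, ?_⟩
      · rcases Finset.mem_insert.1 hi with rfl | hi
        · simp
        · rw [Function.update_of_ne (ne_of_mem_of_not_mem hi hj)]
          exact hc i hi
      · rw [Finset.sum_insert hj, Function.update_self, zero_smul, zero_add, hψ]
        refine Finset.sum_congr rfl fun i hi => ?_
        rw [Function.update_of_ne (ne_of_mem_of_not_mem hi hj)]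
    · push Not at hs
      obtain ⟨x₀, hx₀, hψ₀⟩ := hs
      have hφ₀ : φ j x₀ < 0 := by
        by_contra hcon
        push Not at hcon
        refine absurd (h x₀ fun i hi => ?_) (not_le.2 hψ₀)
        rcases Finset.mem_insert.1 hi with rfl | hi
        · exact hcon
        · exact hx₀ i hi
      obtain ⟨x, hx, hψx, hφx⟩ : ∃ x, (∀ i ∈ s, 0 ≤ φ i x) ∧ ψ x < 0 ∧ φ j x = -1 := by
        have hpos : 0 < (-φ j x₀)⁻¹ := inv_pos.2 (neg_pos.2 hφ₀)
        refine ⟨(-φ j x₀)⁻¹ • x₀, fun i hi => ?_, ?_, ?_⟩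
        · rw [map_smul, smul_eq_mul]
          exact mul_nonneg hpos.le (hx₀ i hi)
        · rw [map_smul, smul_eq_mul]
          exact mul_neg_of_pos_of_neg hpos hψ₀
        · rw [map_smul, smul_eq_mul]
          have := hφ₀.ne
          field_simp
      -- Since `φ j x = -1`, the map `w ↦ w + φ j w • x` projects onto the kernel of `φ j`. The
      -- induction hypothesis is applied to the functionals composed with it. Expanding the result
      -- leaves the coefficient `∑ c i * φ i x - ψ x` for `φ j`, which is nonnegative because `ψ x <
      -- 0`.
      obtain ⟨c, hc, hψ⟩ := ih (fun i => φ i + φ i x • φ j) (ψ + ψ x • φ j) fun w hw => by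
        have key := h (w + φ j w • x) fun i hi => by
          rcases Finset.mem_insert.1 hi with rfl | hi
          · simp [hφx]
          · have := hw i hi
            simp only [LinearMap.add_apply, LinearMap.smul_apply, smul_eq_mul] at this
            rw [map_add, map_smul, smul_eq_mul]
            linarith
        rw [map_add, map_smul, smul_eq_mul] at key
        simp only [LinearMap.add_apply, LinearMap.smul_apply, smul_eq_mul]
        linarith
      refine ⟨Function.update c j (∑ i ∈ s, c i * φ i x - ψ x), fun i hi => ?_, ?_⟩
      · rcases Finset.mem_insert.1 hi with rfl | hi
        · rw [Function.update_self]
          have := Finset.sum_nonneg fun i hi => mul_nonneg (hc i hi) (hx i hi)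
          linarith
        · rw [Function.update_of_ne (ne_of_mem_of_not_mem hi hj)]
          exact hc i hi
      · rw [Finset.sum_insert hj, Function.update_self]
        have hsum : ∑ i ∈ s, Function.update c j (∑ i ∈ s, c i * φ i x - ψ x) i • φ i
            = ∑ i ∈ s, c i • φ i :=
          Finset.sum_congr rfl fun i hi => by
            rw [Function.update_of_ne (ne_of_mem_of_not_mem hi hj)]
        rw [hsum]
        ext w
        have := LinearMap.congr_fun hψ w
        simp only [LinearMap.add_apply, LinearMap.smul_apply, LinearMap.sum_apply, smul_eq_mul,
          mul_add, Finset.sum_add_distrib, ← mul_assoc, ← Finset.sum_mul] at this ⊢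
        linarith

/-- Strong duality, with attainment on both sides, for the linear program which maximizes
`∑ i, p i * f i` over the representations of `μ` as a convex combination of the points `k i`. -/
theorem exists_weights_and_affine_majorant {ι V : Type*} [Fintype ι] [NormedAddCommGroup V]
    [NormedSpace ℝ V] (k : ι → V) (f : ι → ℝ) (μ : V) (hμ : ∃ p ∈ stdSimplex ℝ ι, ∑ i, p i • k i = μ) :
    ∃ p ∈ stdSimplex ℝ ι, ∑ i, p i • k i = μ ∧
      ∃ (φ : V →ₗ[ℝ] ℝ) (c : ℝ), (∀ i, f i ≤ φ (k i) + c) ∧ φ μ + c ≤ ∑ i, p i * f i := by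
  have hcomp : IsCompact (stdSimplex ℝ ι ∩ {p | ∑ i, p i • k i = μ}) :=
    (isCompact_stdSimplex ℝ ι).inter_right (isClosed_eq (by fun_prop) continuous_const)
  have hne : (stdSimplex ℝ ι ∩ {p | ∑ i, p i • k i = μ}).Nonempty := hμ
  obtain ⟨p, ⟨hp, hpμ⟩, hmax⟩ := hcomp.exists_isMaxOn hne
    (f := fun p : ι → ℝ => ∑ i, p i * f i) (by fun_prop)
  refine ⟨p, hp, hpμ, ?_⟩
  set val := ∑ i, p i * f i with hval
  let ev (v : V) (a b : ℝ) : (Module.Dual ℝ V × ℝ × ℝ) →ₗ[ℝ] ℝ :=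
    (Module.Dual.eval ℝ V v).comp (LinearMap.fst ℝ _ _) +
      (a • LinearMap.fst ℝ ℝ ℝ + b • LinearMap.snd ℝ ℝ ℝ).comp (LinearMap.snd ℝ _ _)
  have ev_apply (v : V) (a b : ℝ) (m : Module.Dual ℝ V) (c t : ℝ) :
      ev v a b (m, c, t) = m v + (a * c + b * t) := by simp [ev]
  by_contra hcon
  push Not at hcon
  -- The dual constraints are homogenized by a scale `t`: `m (k i) + c ≥ t * f i` and `m μ + c ≤ t *
  -- val`. A solution with `t > 0` could be rescaled to contradict `hcon`, so the constraints force
  -- `-t ≥ 0`, and Farkas' lemma applies.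
  obtain ⟨c, hc, hψ⟩ := farkas_finset (Finset.univ : Finset (Option ι))
    (fun o => o.elim (-ev μ 1 (-val)) fun i => ev (k i) 1 (-f i)) (ev 0 0 (-1)) (by
      rintro ⟨m, c, t⟩ hw
      rw [ev_apply, map_zero]
      by_contra ht
      have htpos : 0 < t := by linarith
      have h₁ := hcon (t⁻¹ • m) (t⁻¹ * c) fun i => by
        have := hw (some i) (Finset.mem_univ _)
        simp only [Option.elim, ev_apply] at this
        rw [LinearMap.smul_apply, smul_eq_mul, ← mul_add, le_inv_mul_iff₀ htpos]
        linarith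
      have h₂ := hw none (Finset.mem_univ _)
      simp only [Option.elim, LinearMap.neg_apply, ev_apply] at h₂
      rw [LinearMap.smul_apply, smul_eq_mul, ← mul_add, lt_inv_mul_iff₀ htpos] at h₁
      linarith)
  have hψ' (m : Module.Dual ℝ V) (b t : ℝ) :
      -t = c none * -(m μ + (b - val * t)) + ∑ i, c (some i) * (m (k i) + (b - f i * t)) := by
    have := LinearMap.congr_fun hψ (m, b, t)
    rw [ev_apply] at this
    simp only [Fintype.sum_option, Option.elim, LinearMap.add_apply, LinearMap.smul_apply,
      LinearMap.neg_apply, LinearMap.sum_apply, ev_apply, smul_eq_mul, map_zero] at this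
    simpa [← sub_eq_add_neg] using this
  have hsum : ∑ i, c (some i) = c none := by
    have := hψ' 0 1 0
    simp only [LinearMap.zero_apply, mul_zero, sub_zero, zero_add, mul_one, neg_zero] at this
    linarith
  have hcost : ∑ i, c (some i) * f i = 1 + c none * val := by
    have := hψ' 0 0 1
    simp only [LinearMap.zero_apply, mul_one, zero_sub, zero_add, mul_neg,
      Finset.sum_neg_distrib] at this
    linarith
  have hpt : ∑ i, c (some i) • k i = c none • μ := by
    rw [← sub_eq_zero, ← Module.forall_dual_apply_eq_zero_iff ℝ]
    intro m
    have := hψ' m 0 0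
    simp only [mul_zero, sub_zero, add_zero, neg_zero] at this
    simp only [map_sub, map_sum, map_smul, smul_eq_mul]
    linarith
  have hc' (i) : 0 ≤ c (some i) := hc _ (Finset.mem_univ _)
  -- If the multiplier of the value constraint vanishes, so do all the others, and `hcost` reads `0
  -- = 1`. Otherwise dividing by it gives feasible weights of value `val + 1 / c none`, against the
  -- maximality of `p`.
  rcases (hc none (Finset.mem_univ _)).eq_or_lt with h0 | hpos
  · rw [← h0, Finset.sum_eq_zero_iff_of_nonneg fun i _ => hc' i] at hsum
    rw [← h0, Finset.sum_eq_zero fun i hi => by rw [hsum i hi, zero_mul]] at hcost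
    linarith
  · have := hmax (show (fun i => (c none)⁻¹ * c (some i)) ∈ _ from
      ⟨⟨fun i => mul_nonneg (inv_nonneg.2 hpos.le) (hc' i), by
        rw [← Finset.mul_sum, hsum, inv_mul_cancel₀ hpos.ne']⟩, by
        simp only [mem_ofPred_eq, mul_smul]
        rw [← Finset.smul_sum, hpt, inv_smul_smul₀ hpos.ne']⟩)
    simp only [mem_ofPred_eq, mul_assoc] at this
    rw [← Finset.mul_sum, hcost, ← hval, inv_mul_le_iff₀ hpos] at this
    linarith

/-! ### Upper semicontinuity of convex functions on polytopes. -/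

/-- A set which contains, for points `y` of the set near `x`, the dilation of `y` from `x`
by any prescribed factor. Polytopes have this property. -/
def LocallyConic {E : Type*} [TopologicalSpace E] [AddCommGroup E] [Module ℝ E]
    (S : Set E) : Prop :=
  ∀ x ∈ S, ∀ r : ℝ, 0 < r → ∀ᶠ y in 𝓝 x, y ∈ S → x + r • (y - x) ∈ S

theorem LocallyConic.prod {E F : Type*} [TopologicalSpace E] [AddCommGroup E] [Module ℝ E]
    [TopologicalSpace F] [AddCommGroup F] [Module ℝ F] {S : Set E} {S' : Set F}
    (hS : LocallyConic S) (hS' : LocallyConic S') : LocallyConic (S ×ˢ S') := by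
  rintro ⟨x, x'⟩ ⟨hx, hx'⟩ r hr
  filter_upwards [(hS x hx r hr).prod_inl_nhds x', (hS' x' hx' r hr).prod_inr_nhds x]
    with y hy hy' hyS
  exact ⟨hy hyS.1, hy' hyS.2⟩

theorem LocallyConic.pi {ι : Type*} [Finite ι] {E : ι → Type*} [∀ i, TopologicalSpace (E i)]
    [∀ i, AddCommGroup (E i)] [∀ i, Module ℝ (E i)] {S : ∀ i, Set (E i)}
    (hS : ∀ i, LocallyConic (S i)) : LocallyConic (univ.pi S) := by
  intro x hx r hr
  have h (i) : ∀ᶠ y in 𝓝 x, y i ∈ S i → x i + r • (y i - x i) ∈ S i :=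
    (continuous_apply i).continuousAt.eventually (hS i (x i) (hx i trivial) r hr)
  filter_upwards [eventually_all.2 h] with y hy hyS i _
  exact hy i (hyS i trivial)

theorem locallyConic_singleton {E : Type*} [TopologicalSpace E] [AddCommGroup E] [Module ℝ E]
    (a : E) : LocallyConic {a} := by
  rintro x rfl r -
  exact Eventually.of_forall fun y hy => by rw [mem_singleton_iff.1 hy]; simp

/-- A bound that is strict at `x` survives by continuity; a bound that is tight at `x` survives
because the dilation moves away from it. -/
theorem locallyConic_Icc (a b : ℝ) : LocallyConic (Icc a b) := by
  intro x hx r hr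
  have hcont : Tendsto (fun y => x + r • (y - x)) (𝓝 x) (𝓝 x) := by
    have : Continuous fun y => x + r • (y - x) := by fun_prop
    simpa using this.tendsto x
  have ha : ∀ᶠ y in 𝓝 x, a ≤ y → a ≤ x + r • (y - x) := by
    rcases hx.1.eq_or_lt with rfl | h
    · exact Eventually.of_forall fun y hy =>
        le_add_of_nonneg_right (mul_nonneg hr.le (sub_nonneg.2 hy))
    · exact (hcont.eventually_const_lt h).mono fun y hy _ => hy.le
  have hb : ∀ᶠ y in 𝓝 x, y ≤ b → x + r • (y - x) ≤ b := by
    rcases hx.2.eq_or_lt with rfl | h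
    · exact Eventually.of_forall fun y hy =>
        add_le_of_nonpos_right (mul_nonpos_of_nonneg_of_nonpos hr.le (sub_nonpos.2 hy))
    · exact (hcont.eventually_lt_const h).mono fun y hy _ => hy.le
  filter_upwards [ha, hb] with y hya hyb hy
  exact ⟨hya hy.1, hyb hy.2⟩

/-- A convex function that is bounded above on a locally conic set is upper semicontinuous on it. -/
theorem ConvexOn.upperSemicontinuousOn {E : Type*} [TopologicalSpace E] [AddCommGroup E]
    [Module ℝ E] {S : Set E} (hS : LocallyConic S) {f : E → ℝ} (hf : ConvexOn ℝ S f)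
    (hbdd : BddAbove (f '' S)) : UpperSemicontinuousOn f S := by
  obtain ⟨C, hC⟩ := hbdd
  intro x hx c hc
  have hCx : f x ≤ C := hC (mem_image_of_mem f hx)
  -- With this weight `(1 - ε) * f x + ε * C < c`, and `y` is the combination, with weight `ε`, of
  -- `x` and the dilated point, where `f ≤ C`. The extra `c - f x` keeps the denominator positive
  -- when `C = f x`.
  set ε := (c - f x) / (C - f x + (c - f x)) with hε
  have hden : 0 < C - f x + (c - f x) := by linarith
  have hε0 : 0 < ε := div_pos (sub_pos.2 hc) hden
  have hε1 : ε ≤ 1 := (div_le_one hden).2 (by linarith)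
  have hεC : ε * (C - f x) < c - f x := by
    rw [hε, div_mul_eq_mul_div, div_lt_iff₀ hden]
    nlinarith
  rw [eventually_nhdsWithin_iff]
  filter_upwards [hS x hx ε⁻¹ (inv_pos.2 hε0)] with y hy hyS
  have hv := hy hyS
  have hcomb : (1 - ε) • x + ε • (x + ε⁻¹ • (y - x)) = y := by
    rw [smul_add, smul_inv_smul₀ hε0.ne', sub_smul, one_smul]
    abel
  have h₁ := hf.2 hx hv (sub_nonneg.2 hε1) hε0.le (by ring)
  have h₂ : f (x + ε⁻¹ • (y - x)) ≤ C := hC (mem_image_of_mem f hv)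
  rw [hcomb, smul_eq_mul, smul_eq_mul] at h₁
  nlinarith

/-- Leaving the closed set only drops the value to `0`, which preserves upper semicontinuity. This
turns semicontinuity on a fiber into Borel measurability on the whole space. -/
theorem UpperSemicontinuousOn.indicator_of_isClosed {E : Type*} [TopologicalSpace E] {S : Set E}
    {f : E → ℝ} (hf : UpperSemicontinuousOn f S) (hS : IsClosed S) (h0 : ∀ x ∈ S, 0 ≤ f x) :
    UpperSemicontinuous (S.indicator f) := by
  intro x c hc
  by_cases hx : x ∈ S
  · rw [indicator_of_mem hx] at hc
    filter_upwards [eventually_nhdsWithin_iff.1 (hf x hx c hc)] with y hy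
    by_cases hyS : y ∈ S
    · rw [indicator_of_mem hyS]; exact hy hyS
    · rw [indicator_of_notMem hyS]; exact (h0 x hx).trans_lt hc
  · rw [indicator_of_notMem hx] at hc
    filter_upwards [hS.isOpen_compl.mem_nhds hx] with y hy
    rwa [indicator_of_notMem hy]

/-! ### The support as a finite union of boxes, and its vertices. -/

section Support

instance Scenario.instBorelSpace {I T L : Type*} [Finite I] [Finite T] [Finite L]
    {A : Finset (I × I)} : BorelSpace (Scenario I T L A) := by
  have h₁ : BorelSpace ((T → I → L → ℝ) × (A → L → ℝ)) := inferInstance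
  have h₂ : BorelSpace ((I → L → ℝ) × (T → I → L → ℝ) × (A → L → ℝ)) := Prod.borelSpace
  have h₃ : BorelSpace ((T → I → L → ℝ) × (I → L → ℝ) × (T → I → L → ℝ) × (A → L → ℝ)) :=
    Prod.borelSpace
  exact Prod.borelSpace

variable {I T L : Type*} {A : Finset (I × I)}

/-- The box of arrays with nonnegative entries between `lo` and `hi`. -/
def nonnegBox {α β : Type*} (lo hi : α → β → ℝ) : Set (α → β → ℝ) :=
  univ.pi fun i => univ.pi fun l => Icc (max 0 (lo i l)) (hi i l)

/-- The vertices of `nonnegBox lo hi`, if this box is nonempty. -/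
def boxCorners {α β : Type*} (lo hi : α → β → ℝ) : Set (α → β → ℝ) :=
  univ.pi fun i => univ.pi fun l => {max 0 (lo i l), hi i l}

theorem mem_nonnegBox {α β : Type*} {lo hi x : α → β → ℝ} :
    x ∈ nonnegBox lo hi ↔ ∀ i l, 0 ≤ x i l ∧ lo i l ≤ x i l ∧ x i l ≤ hi i l := by
  simp only [nonnegBox, mem_univ_pi, mem_Icc, max_le_iff, and_assoc]

/-- Convex hulls commute with products, and in each coordinate the hull of the two endpoints is the
interval. Nonemptiness ensures that the endpoints are in order. -/
theorem convexHull_boxCorners {α β : Type*} [Finite α] [Finite β] {lo hi : α → β → ℝ}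
    (h : (nonnegBox lo hi).Nonempty) : convexHull ℝ (boxCorners lo hi) = nonnegBox lo hi := by
  obtain ⟨x, hx⟩ := h
  rw [mem_nonnegBox] at hx
  simp only [boxCorners, nonnegBox, convexHull_pi]
  refine pi_congr rfl fun i _ => pi_congr rfl fun l _ => ?_
  obtain ⟨h₁, h₂, h₃⟩ := hx i l
  rw [convexHull_pair, segment_eq_Icc ((max_le h₁ h₂).trans h₃)]

theorem finite_boxCorners {α β : Type*} [Finite α] [Finite β] (lo hi : α → β → ℝ) :
    (boxCorners lo hi).Finite :=
  Finite.pi fun _ => Finite.pi fun _ => toFinite _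

theorem isClosed_nonnegBox {α β : Type*} (lo hi : α → β → ℝ) : IsClosed (nonnegBox lo hi) :=
  isClosed_set_pi fun _ _ => isClosed_set_pi fun _ _ => isClosed_Icc

theorem locallyConic_nonnegBox {α β : Type*} [Finite α] [Finite β] (lo hi : α → β → ℝ) :
    LocallyConic (nonnegBox lo hi) :=
  .pi fun _ => .pi fun _ => locallyConic_Icc _ _

namespace SupportData

/-- The disaster patterns of the support. -/
def patterns (B : SupportData I T L A) : Set (I → L → ℝ) :=
  {q | (∀ i l, q i l = 0 ∨ q i l = 1) ∧ q ∈ B.qSide}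

/-- The part of the support with disaster pattern `q₀`. -/
def fiber (B : SupportData I T L A) (q₀ : I → L → ℝ) : Set (Scenario I T L A) :=
  {q₀} ×ˢ (univ.pi fun t => nonnegBox (B.lo.d t) (B.hi.d t)) ×ˢ nonnegBox B.lo.rho B.hi.rho ×ˢ
    (univ.pi fun t => nonnegBox (B.lo.M t) (B.hi.M t)) ×ˢ nonnegBox B.lo.V B.hi.V

/-- The vertices of `B.fiber q₀`, if this fiber is nonempty. -/
def fiberCorners (B : SupportData I T L A) (q₀ : I → L → ℝ) : Set (Scenario I T L A) :=
  {q₀} ×ˢ (univ.pi fun t => boxCorners (B.lo.d t) (B.hi.d t)) ×ˢ boxCorners B.lo.rho B.hi.rho ×ˢ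
    (univ.pi fun t => boxCorners (B.lo.M t) (B.hi.M t)) ×ˢ boxCorners B.lo.V B.hi.V

theorem mem_fiber {B : SupportData I T L A} {q₀ : I → L → ℝ} {ξ : Scenario I T L A} :
    ξ ∈ B.fiber q₀ ↔ ξ.q = q₀ ∧
      (∀ t i l, 0 ≤ ξ.d t i l ∧ B.lo.d t i l ≤ ξ.d t i l ∧ ξ.d t i l ≤ B.hi.d t i l) ∧
      (∀ i l, 0 ≤ ξ.rho i l ∧ B.lo.rho i l ≤ ξ.rho i l ∧ ξ.rho i l ≤ B.hi.rho i l) ∧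
      (∀ t i l, 0 ≤ ξ.M t i l ∧ B.lo.M t i l ≤ ξ.M t i l ∧ ξ.M t i l ≤ B.hi.M t i l) ∧
      (∀ a l, 0 ≤ ξ.V a l ∧ B.lo.V a l ≤ ξ.V a l ∧ ξ.V a l ≤ B.hi.V a l) := by
  simp only [fiber, mem_prod, mem_singleton_iff, mem_univ_pi, mem_nonnegBox]
  rfl

theorem mem_R_iff {B : SupportData I T L A} {ξ : Scenario I T L A} :
    ξ ∈ B.R ↔ ξ.q ∈ B.patterns ∧ ξ ∈ B.fiber ξ.q := by
  rw [mem_fiber]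
  simp only [R, patterns, mem_ofPred_eq, true_and]

theorem R_eq_biUnion_fiber (B : SupportData I T L A) : B.R = ⋃ q₀ ∈ B.patterns, B.fiber q₀ := by
  ext ξ
  simp only [mem_iUnion, exists_prop, mem_R_iff]
  refine ⟨fun h => ⟨_, h⟩, ?_⟩
  rintro ⟨q₀, hq₀, hξ⟩
  obtain rfl := (mem_fiber.1 hξ).1
  exact ⟨hq₀, hξ⟩

theorem fiber_subset_R {B : SupportData I T L A} {q₀ : I → L → ℝ} (hq₀ : q₀ ∈ B.patterns) :
    B.fiber q₀ ⊆ B.R := by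
  rw [R_eq_biUnion_fiber]
  exact subset_biUnion_of_mem hq₀

theorem convex_fiber (B : SupportData I T L A) (q₀ : I → L → ℝ) : Convex ℝ (B.fiber q₀) := by
  exact (convex_singleton _).prod <| (convex_pi fun _ _ => convex_pi fun _ _ =>
    convex_pi fun _ _ => convex_Icc _ _).prod <| (convex_pi fun _ _ => convex_pi fun _ _ =>
    convex_Icc _ _).prod <| (convex_pi fun _ _ => convex_pi fun _ _ =>
    convex_pi fun _ _ => convex_Icc _ _).prod <| convex_pi fun _ _ => convex_pi fun _ _ =>
    convex_Icc _ _

theorem isClosed_fiber (B : SupportData I T L A) (q₀ : I → L → ℝ) : IsClosed (B.fiber q₀) :=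
  isClosed_singleton.prod <| (isClosed_set_pi fun _ _ => isClosed_nonnegBox _ _).prod <|
    (isClosed_nonnegBox _ _).prod <| (isClosed_set_pi fun _ _ => isClosed_nonnegBox _ _).prod <|
    isClosed_nonnegBox _ _

/-- The vertices of the support. -/
def corners (B : SupportData I T L A) : Set (Scenario I T L A) :=
  -- Empty fibers are discarded, since their formal corners exist but lie outside the support.
  ⋃ q₀ ∈ {q₀ ∈ B.patterns | (B.fiber q₀).Nonempty}, B.fiberCorners q₀

theorem fiberCorners_subset_corners {B : SupportData I T L A} {ξ : Scenario I T L A}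
    (hξ : ξ ∈ B.R) : B.fiberCorners ξ.q ⊆ B.corners :=
  have h := mem_R_iff.1 hξ
  subset_biUnion_of_mem (u := fun q₀ => B.fiberCorners q₀)
    (show ξ.q ∈ {q₀ ∈ B.patterns | (B.fiber q₀).Nonempty} from ⟨h.1, _, h.2⟩)

variable [Finite I] [Finite L]

theorem finite_patterns (B : SupportData I T L A) : B.patterns.Finite :=
  (Finite.pi fun _ => Finite.pi fun _ => toFinite {(0 : ℝ), 1}).subset fun _ hq i _ l _ => hq.1 i l

theorem isClosed_R (B : SupportData I T L A) : IsClosed B.R := by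
  rw [R_eq_biUnion_fiber]
  exact B.finite_patterns.isClosed_biUnion fun _ _ => B.isClosed_fiber _

variable [Finite T]

theorem locallyConic_fiber (B : SupportData I T L A) (q₀ : I → L → ℝ) :
    LocallyConic (B.fiber q₀) :=
  (locallyConic_singleton q₀).prod <| (LocallyConic.pi fun _ => locallyConic_nonnegBox _ _).prod <|
    (locallyConic_nonnegBox _ _).prod <| (LocallyConic.pi fun _ => locallyConic_nonnegBox _ _).prod <|
    locallyConic_nonnegBox _ _

theorem finite_fiberCorners (B : SupportData I T L A) (q₀ : I → L → ℝ) :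
    (B.fiberCorners q₀).Finite :=
  (finite_singleton _).prod <| (Finite.pi fun _ => finite_boxCorners _ _).prod <|
    (finite_boxCorners _ _).prod <| (Finite.pi fun _ => finite_boxCorners _ _).prod <|
    finite_boxCorners _ _

theorem convexHull_fiberCorners {B : SupportData I T L A} {q₀ : I → L → ℝ}
    (h : (B.fiber q₀).Nonempty) : convexHull ℝ (B.fiberCorners q₀) = B.fiber q₀ := by
  obtain ⟨ξ, -, hd, hrho, hM, hV⟩ := h
  simp only [fiberCorners, fiber, convexHull_prod, convexHull_pi, convexHull_singleton]
  rw [convexHull_boxCorners ⟨_, hrho⟩, convexHull_boxCorners ⟨_, hV⟩,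
    pi_congr rfl fun t _ => convexHull_boxCorners ⟨_, hd t trivial⟩,
    pi_congr rfl fun t _ => convexHull_boxCorners ⟨_, hM t trivial⟩]

theorem finite_corners (B : SupportData I T L A) : B.corners.Finite :=
  (B.finite_patterns.subset (sep_subset _ _)).biUnion fun _ _ => B.finite_fiberCorners _

theorem corners_subset_R (B : SupportData I T L A) : B.corners ⊆ B.R :=
  iUnion₂_subset fun _ hq => (subset_convexHull ℝ _).trans <|
    (convexHull_fiberCorners hq.2).trans_subset (fiber_subset_R hq.1)

theorem R_subset_convexHull_corners (B : SupportData I T L A) : B.R ⊆ convexHull ℝ B.corners := by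
  intro ξ hξ
  have h := (mem_R_iff.1 hξ).2
  rw [← convexHull_fiberCorners ⟨ξ, h⟩] at h
  exact convexHull_mono (fiberCorners_subset_corners hξ) h

end SupportData

end Support

/-! ### Convexity, boundedness and integrability of the recourse value. -/

section Recourse

variable {I T L : Type*} {A : Finset (I × I)}

/-- The convex combination of two second-stage decisions. -/
def Recourse.combo (a b : ℝ) (r r' : Recourse I T A) : Recourse I T A where
  y t i := a * r.y t i + b * r'.y t i
  u t i := a * r.u t i + b * r'.u t i
  e t i := a * r.e t i + b * r'.e t i
  x c t := a * r.x c t + b * r'.x c t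

namespace ReliefData

variable {D : ReliefData I T L A} {w : FirstStage I T}

theorem recourseCost_combo [Fintype I] [Fintype T] (D : ReliefData I T L A) (a b : ℝ) (r r' : Recourse I T A) :
    D.recourseCost (r.combo a b r') = a * D.recourseCost r + b * D.recourseCost r' := by
  simp only [recourseCost, Recourse.combo, mul_add, Finset.mul_sum, Finset.sum_add_distrib,
    mul_left_comm]
  ring

variable [DecidableEq I] [Fintype T] [Fintype L]

/-- Every product of uncertain parameters in the constraints has a factor `q`, so for a common `q`
both sides are jointly affine in the scenario and the decision. -/
theorem RecourseFeasible.combo {ξ ξ' : Scenario I T L A} {r r' : Recourse I T A}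
    (hr : D.RecourseFeasible w ξ r) (hr' : D.RecourseFeasible w ξ' r') (hq : ξ.q = ξ'.q)
    {a b : ℝ} (ha : 0 ≤ a) (hb : 0 ≤ b) (hab : a + b = 1) :
    D.RecourseFeasible w (a • ξ + b • ξ') (r.combo a b r') := by
  obtain ⟨h₁, h₂, h₃, h₄, hy, he, hu, hx⟩ := hr
  obtain ⟨h₁', h₂', h₃', h₄', hy', he', hu', hx'⟩ := hr'
  obtain rfl : b = 1 - a := by linarith
  have hqq (i l) : (a • ξ + (1 - a) • ξ').q i l = ξ'.q i l := by
    change a * ξ.q i l + (1 - a) * ξ'.q i l = _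
    rw [hq]; ring
  have hcap (c k) : D.arcCap (a • ξ + (1 - a) • ξ') c k
      = a * D.arcCap ξ c k + (1 - a) * D.arcCap ξ' c k := by
    have hs : ∑ l, ξ'.q k l * (a * ξ.V c l + (1 - a) * ξ'.V c l)
        = a * ∑ l, ξ'.q k l * ξ.V c l + (1 - a) * ∑ l, ξ'.q k l * ξ'.V c l := by
      simp only [mul_add, Finset.mul_sum, Finset.sum_add_distrib, mul_left_comm]
    simp only [arcCap, hqq, hq]
    change ∑ l, ξ'.q k l * (a * ξ.V c l + (1 - a) * ξ'.V c l) + _ = _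
    rw [hs]
    ring
  have hvol (c : A) : ∑ t, D.v t * (r.combo a (1 - a) r').x c t
      = a * ∑ t, D.v t * r.x c t + (1 - a) * ∑ t, D.v t * r'.x c t := by
    simp only [Recourse.combo, mul_add, Finset.mul_sum, Finset.sum_add_distrib, mul_left_comm]
  have hnonneg {x x' : ℝ} (h : 0 ≤ x) (h' : 0 ≤ x') : 0 ≤ a * x + (1 - a) * x' := by positivity
  have hle {x x' y y' : ℝ} (h : x ≤ y) (h' : x' ≤ y') :
      a * x + (1 - a) * x' ≤ a * y + (1 - a) * y' := by gcongr
  refine ⟨fun t i => ?_, fun t i => ?_, fun c => ?_, fun c => ?_, fun t i => hnonneg (hy t i) (hy' t i),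
    fun t i => hnonneg (he t i) (he' t i), fun t i => hnonneg (hu t i) (hu' t i),
    fun c t => hnonneg (hx c t) (hx' c t)⟩
  · have hs : ∑ l, ξ'.q i l * ((a * ξ.d t i l + (1 - a) * ξ'.d t i l)
          - (a * ξ.rho i l + (1 - a) * ξ'.rho i l) * w.z t i)
        = a * ∑ l, ξ'.q i l * (ξ.d t i l - ξ.rho i l * w.z t i)
          + (1 - a) * ∑ l, ξ'.q i l * (ξ'.d t i l - ξ'.rho i l * w.z t i) := by
      simp only [Finset.mul_sum, ← Finset.sum_add_distrib]
      exact Finset.sum_congr rfl fun l _ => by ring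
    have h := h₁ t i
    have h' := h₁' t i
    simp only [hq] at h
    simp only [hqq]
    change _ = ∑ l, ξ'.q i l * ((a * ξ.d t i l + (1 - a) * ξ'.d t i l)
          - (a * ξ.rho i l + (1 - a) * ξ'.rho i l) * w.z t i) - _
    rw [hs]
    simp only [Recourse.combo, Finset.sum_add_distrib, ← Finset.mul_sum]
    linear_combination a * h + (1 - a) * h'
  · have hs : ∑ l, ξ'.q i l * (a * ξ.M t i l + (1 - a) * ξ'.M t i l)
        = a * ∑ l, ξ.q i l * ξ.M t i l + (1 - a) * ∑ l, ξ'.q i l * ξ'.M t i l := by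
      simp only [hq, mul_add, Finset.mul_sum, Finset.sum_add_distrib, mul_left_comm]
    simp only [hqq]
    refine (hle (h₂ t i) (h₂' t i)).trans_eq hs.symm
  · rw [hvol, hcap]
    exact hle (h₃ c) (h₃' c)
  · rw [hvol, hcap]
    exact hle (h₄ c) (h₄' c)

variable [Fintype I]

theorem recourseCost_nonneg {ξ : Scenario I T L A} {r : Recourse I T A}
    (hr : D.RecourseFeasible w ξ r) : 0 ≤ D.recourseCost r := by
  obtain ⟨-, -, -, -, hy, he, hu, hx⟩ := hr
  refine add_nonneg (Finset.sum_nonneg fun i _ => Finset.sum_nonneg fun t _ => ?_)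
    (Finset.sum_nonneg fun t _ => Finset.sum_nonneg fun a _ => mul_nonneg (D.ct_nonneg a t) (hx a t))
  exact add_nonneg (add_nonneg (mul_nonneg (D.cp_nonneg t) (hy t i))
    (mul_nonneg (D.cu_nonneg t) (hu t i))) (mul_nonneg (D.ch_nonneg t) (he t i))

theorem bddBelow_cost (D : ReliefData I T L A) (w : FirstStage I T) (ξ : Scenario I T L A) :
    BddBelow (D.recourseCost '' {r | D.RecourseFeasible w ξ r}) := by
  refine ⟨0, ?_⟩
  rintro _ ⟨r, hr, rfl⟩
  exact recourseCost_nonneg hr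

theorem Q_nonneg (D : ReliefData I T L A) (w : FirstStage I T) (ξ : Scenario I T L A) :
    0 ≤ D.Q w ξ := by
  refine Real.sInf_nonneg ?_
  rintro _ ⟨r, hr, rfl⟩
  exact recourseCost_nonneg hr

variable {B : SupportData I T L A}

/-- For a fixed disaster pattern the recourse value is convex in the other parameters. -/
theorem convexOn_Q (hrec : ∀ ξ ∈ B.R, ∃ r, D.RecourseFeasible w ξ r) {q₀ : I → L → ℝ}
    (hq₀ : q₀ ∈ B.patterns) : ConvexOn ℝ (B.fiber q₀) (D.Q w) := by
  refine ⟨B.convex_fiber q₀, fun ξ hξ ξ' hξ' a b ha hb hab => ?_⟩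
  have hq : ξ.q = ξ'.q := (SupportData.mem_fiber.1 hξ).1.trans (SupportData.mem_fiber.1 hξ').1.symm
  have hne {ζ} (h : ζ ∈ B.fiber q₀) :
      (D.recourseCost '' {r | D.RecourseFeasible w ζ r}).Nonempty :=
    Set.Nonempty.image _ (hrec ζ (SupportData.fiber_subset_R hq₀ h))
  -- Working with `ε`-optimal decisions avoids proving that the recourse minimum is attained.
  refine le_of_forall_pos_le_add fun ε hε => ?_
  obtain ⟨_, ⟨r, hr, rfl⟩, hlt⟩ := Real.lt_sInf_add_pos (hne hξ) hε
  obtain ⟨_, ⟨r', hr', rfl⟩, hlt'⟩ := Real.lt_sInf_add_pos (hne hξ') hε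
  have h := csInf_le (D.bddBelow_cost w (a • ξ + b • ξ'))
    (mem_image_of_mem _ (hr.combo hr' hq ha hb hab))
  rw [recourseCost_combo] at h
  refine h.trans ?_
  change a * D.recourseCost r + b * D.recourseCost r' ≤ a * D.Q w ξ + b * D.Q w ξ' + ε
  have h₁ := mul_le_mul_of_nonneg_left (show D.recourseCost r ≤ D.Q w ξ + ε from hlt.le) ha
  have h₂ := mul_le_mul_of_nonneg_left (show D.recourseCost r' ≤ D.Q w ξ' + ε from hlt'.le) hb
  have h₃ : a * ε + b * ε = ε := by rw [← add_mul, hab, one_mul]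
  linarith

/-- A function that differs from the recourse value by a linear function is dominated on the
support by its values at the vertices. -/
theorem exists_corner_ge (hrec : ∀ ξ ∈ B.R, ∃ r, D.RecourseFeasible w ξ r)
    (φ : Scenario I T L A →ₗ[ℝ] ℝ) {ξ : Scenario I T L A} (hξ : ξ ∈ B.R) :
    ∃ k ∈ B.corners, D.Q w ξ - φ ξ ≤ D.Q w k - φ k := by
  have h := SupportData.mem_R_iff.1 hξ
  have hconv := (convexOn_Q hrec h.1).sub (φ.concaveOn (B.convex_fiber ξ.q))
  have hhull := SupportData.convexHull_fiberCorners ⟨ξ, h.2⟩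
  obtain ⟨k, hk, hle⟩ := hconv.exists_ge_of_mem_convexHull
    ((subset_convexHull ℝ _).trans_eq hhull) (hhull.symm ▸ h.2)
  exact ⟨k, SupportData.fiberCorners_subset_corners hξ hk, hle⟩

theorem bddAbove_Q (hrec : ∀ ξ ∈ B.R, ∃ r, D.RecourseFeasible w ξ r) :
    BddAbove (D.Q w '' B.R) := by
  obtain ⟨C, hC⟩ := (B.finite_corners.image (D.Q w)).bddAbove
  refine ⟨C, ?_⟩
  rintro _ ⟨ξ, hξ, rfl⟩
  obtain ⟨k, hk, hle⟩ := exists_corner_ge hrec 0 hξ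
  simp only [LinearMap.zero_apply, sub_zero] at hle
  exact hle.trans (hC (mem_image_of_mem _ hk))

theorem integrable_Q (hrec : ∀ ξ ∈ B.R, ∃ r, D.RecourseFeasible w ξ r)
    {P : Measure (Scenario I T L A)} [IsFiniteMeasure P] (hP : P B.Rᶜ = 0) :
    Integrable (D.Q w) P := by
  obtain ⟨C, hC⟩ := bddAbove_Q hrec
  -- Convexity is available only for a fixed pattern, so integrability is checked on each of the
  -- finitely many fibers.
  rw [← Measure.restrict_eq_self_of_ae_mem (s := B.R) hP, SupportData.R_eq_biUnion_fiber]
  refine (integrableOn_finite_biUnion B.finite_patterns).2 fun q₀ hq₀ => ?_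
  have hsub := SupportData.fiber_subset_R hq₀
  have hclosed := B.isClosed_fiber q₀
  have husc := (convexOn_Q hrec hq₀).upperSemicontinuousOn (B.locallyConic_fiber q₀)
    (BddAbove.mono (image_mono hsub) ⟨C, hC⟩)
  rw [← integrable_indicator_iff hclosed.measurableSet]
  refine .of_bound (husc.indicator_of_isClosed hclosed
    fun ξ _ => D.Q_nonneg w ξ).measurable.aestronglyMeasurable |C| (ae_of_all _ fun ξ => ?_)
  by_cases hξ : ξ ∈ B.fiber q₀
  · rw [indicator_of_mem hξ, Real.norm_of_nonneg (D.Q_nonneg w ξ)]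
    exact (hC (mem_image_of_mem _ (hsub hξ))).trans (le_abs_self C)
  · rw [indicator_of_notMem hξ, norm_zero]
    exact abs_nonneg C

end ReliefData

end Recourse

/-! ### Multipliers as linear functionals, and the moment conditions. -/

section Duality

variable {I T L : Type*} [Fintype I] [Fintype T] [Fintype L] {A : Finset (I × I)}

/-- The pairing with given multipliers as a linear functional. -/
def Multipliers.toLinearMap (m : Multipliers I T L A) : Scenario I T L A →ₗ[ℝ] ℝ where
  toFun := m.pairing
  map_add' ξ ξ' := by
    change ∑ l, (∑ i, ∑ t, ((ξ.d t i l + ξ'.d t i l) * _ + (ξ.M t i l + ξ'.M t i l) * _)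
      + ∑ i, ((ξ.rho i l + ξ'.rho i l) * _ + (ξ.q i l + ξ'.q i l) * _)
      + ∑ a, (ξ.V a l + ξ'.V a l) * _) = _
    simp only [pairing, add_mul, Finset.sum_add_distrib]
    ring
  map_smul' c ξ := by
    change ∑ l, (∑ i, ∑ t, (c * ξ.d t i l * _ + c * ξ.M t i l * _)
      + ∑ i, (c * ξ.rho i l * _ + c * ξ.q i l * _) + ∑ a, c * ξ.V a l * _) = _
    simp only [pairing, mul_assoc, Finset.sum_add_distrib, ← Finset.mul_sum, ← mul_add]
    rfl

theorem exists_entries {α β : Type*} [Fintype α] [Fintype β] (φ : (α → β → ℝ) →ₗ[ℝ] ℝ) :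
    ∃ c : α → β → ℝ, ∀ x, φ x = ∑ b, ∑ a, x a b * c a b := by
  classical
  refine ⟨fun a b => φ (Pi.single a (Pi.single b 1)), fun x => ?_⟩
  have hx : x = ∑ b, ∑ a, x a b • Pi.single a (Pi.single b (1 : ℝ)) := by
    ext a b
    simp [Finset.sum_apply, Pi.single_apply, apply_ite]
  conv_lhs => rw [hx]
  simp only [map_sum, map_smul, smul_eq_mul]

theorem exists_entries₃ {α β γ : Type*} [Fintype α] [Fintype β] [Fintype γ]
    (φ : (α → β → γ → ℝ) →ₗ[ℝ] ℝ) :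
    ∃ c : α → β → γ → ℝ, ∀ x, φ x = ∑ l, ∑ b, ∑ a, x a b l * c a b l := by
  classical
  choose c hc using fun a => exists_entries (φ.comp (LinearMap.single ℝ (fun _ => β → γ → ℝ) a))
  refine ⟨c, fun x => ?_⟩
  have hx : x = ∑ a, Pi.single a (x a) := (Finset.univ_sum_single x).symm
  conv_lhs => rw [hx, map_sum]
  calc ∑ a, φ (Pi.single a (x a)) = ∑ a, ∑ l, ∑ b, x a b l * c a b l :=
        Finset.sum_congr rfl fun a _ => hc a (x a)
    _ = ∑ l, ∑ a, ∑ b, x a b l * c a b l := Finset.sum_comm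
    _ = _ := Finset.sum_congr rfl fun l _ => Finset.sum_comm

/-- The linear program returns an abstract functional as its dual solution; reading off its values
on the standard basis turns it into multipliers. -/
theorem Multipliers.exists_toLinearMap_eq (φ : Scenario I T L A →ₗ[ℝ] ℝ) :
    ∃ m : Multipliers I T L A, m.toLinearMap = φ := by
  obtain ⟨lam, hlam⟩ := exists_entries (φ.comp (LinearMap.inl ℝ _ _))
  obtain ⟨alpha, halpha⟩ := exists_entries₃
    (φ.comp (LinearMap.inr ℝ _ _ ∘ₗ LinearMap.inl ℝ _ _))
  obtain ⟨gamma, hgamma⟩ := exists_entries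
    (φ.comp (LinearMap.inr ℝ _ _ ∘ₗ LinearMap.inr ℝ _ _ ∘ₗ LinearMap.inl ℝ _ _))
  obtain ⟨phi, hphi⟩ := exists_entries₃ (φ.comp (LinearMap.inr ℝ _ _ ∘ₗ LinearMap.inr ℝ _ _ ∘ₗ
    LinearMap.inr ℝ _ _ ∘ₗ LinearMap.inl ℝ _ _))
  obtain ⟨tau, htau⟩ := exists_entries (φ.comp (LinearMap.inr ℝ _ _ ∘ₗ LinearMap.inr ℝ _ _ ∘ₗ
    LinearMap.inr ℝ _ _ ∘ₗ LinearMap.inr ℝ _ _))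
  refine ⟨⟨alpha, phi, gamma, lam, tau⟩, LinearMap.ext fun ⟨q, d, rho, M, V⟩ => ?_⟩
  have hsplit : ((q, d, rho, M, V) : Scenario I T L A) = (q, 0) + (0, d, 0) + (0, 0, rho, 0)
      + (0, 0, 0, M, 0) + (0, 0, 0, 0, V) := by
    simp
  specialize hlam q
  specialize halpha d
  specialize hgamma rho
  specialize hphi M
  specialize htau V
  simp only [LinearMap.comp_apply, LinearMap.inl_apply, LinearMap.inr_apply]
    at hlam halpha hgamma hphi htau
  rw [hsplit, map_add φ, map_add φ, map_add φ, map_add φ, hlam, halpha, hgamma, hphi, htau,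
    ← hsplit]
  change Multipliers.pairing _ _ = _
  simp only [pairing, Scenario.q, Scenario.d, Scenario.rho, Scenario.M, Scenario.V,
    Finset.sum_add_distrib]
  ring

namespace SupportData

variable {B : SupportData I T L A} {P : Measure (Scenario I T L A)}

theorem integrable_of_measure_compl_R_eq_zero [IsFiniteMeasure P] (hP : P B.Rᶜ = 0) :
    Integrable (fun ξ => ξ) P := by
  have hbdd : Bornology.IsBounded B.R :=
    (isBounded_convexHull.2 B.finite_corners.isBounded).subset B.R_subset_convexHull_corners
  obtain ⟨C, hC⟩ := hbdd.exists_norm_le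
  have hmem : ∀ᵐ ξ ∂P, ξ ∈ B.R := hP
  exact .of_bound aestronglyMeasurable_id C (hmem.mono hC)

/-- The moment conditions say that the vector-valued mean is `μ`. -/
theorem mem_ambiguitySet_iff [IsProbabilityMeasure P] (hP : P B.Rᶜ = 0)
    {μ : Scenario I T L A} : P ∈ B.ambiguitySet μ ↔ ∫ ξ, ξ ∂P = μ := by
  -- Each coordinate is a continuous linear functional, so it commutes with the vector-valued
  -- integral.
  have key (φ : Scenario I T L A →L[ℝ] ℝ) : ∫ ξ, φ ξ ∂P = φ (∫ ξ, ξ ∂P) :=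
    φ.integral_comp_comm (integrable_of_measure_compl_R_eq_zero hP)
  have hq (i l) : ∫ ξ, ξ.q i l ∂P = (∫ ξ, ξ ∂P).q i l :=
    key ⟨⟨⟨fun ξ => ξ.q i l, fun _ _ => rfl⟩, fun _ _ => rfl⟩, by unfold Scenario.q; fun_prop⟩
  have hd (t i l) : ∫ ξ, ξ.d t i l ∂P = (∫ ξ, ξ ∂P).d t i l :=
    key ⟨⟨⟨fun ξ => ξ.d t i l, fun _ _ => rfl⟩, fun _ _ => rfl⟩, by unfold Scenario.d; fun_prop⟩
  have hrho (i l) : ∫ ξ, ξ.rho i l ∂P = (∫ ξ, ξ ∂P).rho i l :=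
    key ⟨⟨⟨fun ξ => ξ.rho i l, fun _ _ => rfl⟩, fun _ _ => rfl⟩, by
      unfold Scenario.rho; fun_prop⟩
  have hM (t i l) : ∫ ξ, ξ.M t i l ∂P = (∫ ξ, ξ ∂P).M t i l :=
    key ⟨⟨⟨fun ξ => ξ.M t i l, fun _ _ => rfl⟩, fun _ _ => rfl⟩, by unfold Scenario.M; fun_prop⟩
  have hV (a l) : ∫ ξ, ξ.V a l ∂P = (∫ ξ, ξ ∂P).V a l :=
    key ⟨⟨⟨fun ξ => ξ.V a l, fun _ _ => rfl⟩, fun _ _ => rfl⟩, by unfold Scenario.V; fun_prop⟩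
  simp only [ambiguitySet, mem_ofPred_eq, hq, hd, hrho, hM, hV]
  constructor
  · rintro ⟨-, -, h₁, h₂, h₃, h₄, h₅⟩
    exact Prod.ext (funext₂ h₁) <| Prod.ext (funext₃ h₂) <| Prod.ext (funext₂ h₃) <|
      Prod.ext (funext₃ h₄) (funext₂ h₅)
  · rintro rfl
    exact ⟨inferInstance, hP, fun _ _ => rfl, fun _ _ _ => rfl, fun _ _ => rfl, fun _ _ _ => rfl,
      fun _ _ => rfl⟩

end SupportData

end Duality

/-! ### Reduction to the vertices and the proof of the duality. -/

theorem integral_sum_dirac {ι Ω F : Type*} [Fintype ι] [MeasurableSpace Ω]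
    [MeasurableSingletonClass Ω] [NormedAddCommGroup F] [NormedSpace ℝ F] [CompleteSpace F]
    {p : ι → ℝ} (hp : ∀ i, 0 ≤ p i) (k : ι → Ω) (f : Ω → F) :
    ∫ x, f x ∂(∑ i, ENNReal.ofReal (p i) • Measure.dirac (k i)) = ∑ i, p i • f (k i) := by
  rw [integral_finsetSum_measure fun i _ =>
    (integrable_dirac (by simp)).smul_measure ENNReal.ofReal_ne_top]
  refine Finset.sum_congr rfl fun i _ => ?_
  rw [integral_smul_measure, integral_dirac, ENNReal.toReal_ofReal (hp i)]

theorem proposition1 {I T L : Type*} [Fintype I] [DecidableEq I] [Fintype T] [Fintype L]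
    {A : Finset (I × I)} (D : ReliefData I T L A) (B : SupportData I T L A)
    (hrec : D.RelativelyCompleteRecourse B)
    (μ : Scenario I T L A) (hμ : (B.ambiguitySet μ).Nonempty)
    (w : FirstStage I T) (hw : D.FirstStageFeasible w) :
    -- the expectations are well defined
    (∀ P ∈ B.ambiguitySet μ, Integrable (D.Q w) P) ∧
    -- the inner maximum over the support is attained
    (∀ m : Multipliers I T L A, ∃ ξ ∈ B.R, IsMaxOn (D.innerObj w m) B.R ξ) ∧
    -- the worst-case expectation is finite and equals the minimum of the dual, which is attained
    ∃ val : ℝ,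
      IsLUB ((fun P => ∫ ξ, D.Q w ξ ∂P) '' B.ambiguitySet μ) val ∧
      IsLeast (Set.range (D.dualObj B μ w)) val := by
  classical
  have hfeas := hrec w hw
  obtain ⟨P₀, hP₀⟩ := hμ
  have hint : ∀ P ∈ B.ambiguitySet μ, Integrable (D.Q w) P := fun P hP =>
    have := hP.1
    ReliefData.integrable_Q hfeas hP.2.1
  have hmean : ∀ P ∈ B.ambiguitySet μ, ∫ ξ, ξ ∂P = μ := fun P hP =>
    have := hP.1
    (SupportData.mem_ambiguitySet_iff hP.2.1).1 hP
  -- the mean lies in the convex hull of the vertices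
  have hμ_hull : μ ∈ convexHull ℝ B.corners := by
    have := hP₀.1
    rw [← hmean P₀ hP₀]
    have hmem : ∀ᵐ ξ ∂P₀, ξ ∈ B.R := hP₀.2.1
    exact (convex_convexHull ℝ _).integral_mem (B.finite_corners.isClosed_convexHull ℝ)
      (hmem.mono fun ξ h => B.R_subset_convexHull_corners h)
      (SupportData.integrable_of_measure_compl_R_eq_zero hP₀.2.1)
  have hcorners : B.corners.Nonempty := convexHull_nonempty_iff.1 ⟨μ, hμ_hull⟩
  -- No continuity is used: the best of the finitely many vertices dominates the whole support.
  have hmax (m : Multipliers I T L A) : ∃ ξ ∈ B.R, IsMaxOn (D.innerObj w m) B.R ξ := by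
    obtain ⟨k, hk, hkmax⟩ := B.finite_corners.exists_maximalFor (D.innerObj w m) _ hcorners
    refine ⟨k, B.corners_subset_R hk, fun ξ hξ => ?_⟩
    obtain ⟨k', hk', hle⟩ := ReliefData.exists_corner_ge hfeas m.toLinearMap hξ
    exact hle.trans ((le_total _ _).elim id (hkmax hk'))
  -- weak duality
  have hweak (P) (hP : P ∈ B.ambiguitySet μ) (m : Multipliers I T L A) :
      ∫ ξ, D.Q w ξ ∂P ≤ D.dualObj B μ w m := by
    have := hP.1
    obtain ⟨ξ₀, -, hξ₀⟩ := hmax m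
    -- The real `sSup` in `dualObj` is a genuine supremum only once the image is known to be bounded
    -- above.
    have hbdd : BddAbove (D.innerObj w m '' B.R) := ⟨_, forall_mem_image.2 hξ₀⟩
    have hid := SupportData.integrable_of_measure_compl_R_eq_zero hP.2.1
    let φ : Scenario I T L A →L[ℝ] ℝ := LinearMap.toContinuousLinearMap m.toLinearMap
    have hφ : ∫ ξ, φ ξ ∂P = m.pairing μ := by
      rw [φ.integral_comp_comm hid, hmean P hP]
      rfl
    have hmem : ∀ᵐ ξ ∂P, ξ ∈ B.R := hP.2.1
    calc ∫ ξ, D.Q w ξ ∂P ≤ ∫ ξ, (φ ξ + sSup (D.innerObj w m '' B.R)) ∂P := by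
          refine integral_mono_ae (hint P hP) ((φ.integrable_comp hid).add (integrable_const _))
            (hmem.mono fun ξ hξ => ?_)
          have h : D.Q w ξ - φ ξ ≤ _ := le_csSup hbdd (mem_image_of_mem _ hξ)
          exact sub_le_iff_le_add'.1 h
      _ = D.dualObj B μ w m := by
          rw [integral_add (φ.integrable_comp hid) (integrable_const _), hφ]
          simp [ReliefData.dualObj]
  -- strong duality for the vertices
  set K := B.finite_corners.toFinset
  have hμK : ∃ p ∈ stdSimplex ℝ K, ∑ k, p k • (k : Scenario I T L A) = μ := by
    rw [← B.finite_corners.coe_toFinset, Finset.mem_convexHull'] at hμ_hull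
    obtain ⟨p, hp, hp₁, hpμ⟩ := hμ_hull
    refine ⟨fun k => p k, ⟨fun k => hp k k.2, ?_⟩, ?_⟩
    · rwa [Finset.sum_coe_sort K p]
    · rwa [Finset.sum_coe_sort K fun k => p k • k]
  obtain ⟨p, hp, hpμ, φ, c, hmaj, hval⟩ :=
    exists_weights_and_affine_majorant (fun k : K => (k : Scenario I T L A)) (fun k => D.Q w k) μ hμK
  obtain ⟨m, hm⟩ := Multipliers.exists_toLinearMap_eq φ
  have hKR (k : K) : (k : Scenario I T L A) ∈ B.R :=
    B.corners_subset_R (B.finite_corners.mem_toFinset.1 k.2)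
  -- The worst-case law: the optimal weights placed on the vertices.
  let P : Measure (Scenario I T L A) := ∑ k : K, ENNReal.ofReal (p k) • Measure.dirac k.1
  have hPprob : IsProbabilityMeasure P := ⟨by
    simp only [P, Measure.finsetSum_apply, Measure.smul_apply, measure_univ, smul_eq_mul, mul_one]
    rw [← ENNReal.ofReal_sum_of_nonneg fun k _ => hp.1 k, hp.2, ENNReal.ofReal_one]⟩
  have hPR : P B.Rᶜ = 0 := by
    simp only [P, Measure.finsetSum_apply, Measure.smul_apply, smul_eq_mul]
    refine Finset.sum_eq_zero fun k _ => ?_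
    rw [Measure.dirac_apply' _ B.isClosed_R.measurableSet.compl,
      indicator_of_notMem (not_not.2 (hKR k)), mul_zero]
  have hPmem : P ∈ B.ambiguitySet μ :=
    (SupportData.mem_ambiguitySet_iff hPR).2 ((integral_sum_dirac hp.1 _ _).trans hpμ)
  have hPval : ∫ ξ, D.Q w ξ ∂P = ∑ k : K, p k * D.Q w k :=
    integral_sum_dirac hp.1 _ _
  -- The majorant is known only at the vertices; `exists_corner_ge` carries the bound `Q - φ ≤ c` to
  -- the whole support.
  have hdual : D.dualObj B μ w m ≤ ∑ k : K, p k * D.Q w k := by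
    refine le_trans ?_ hval
    rw [← hm]
    refine add_le_add_right (csSup_le (.image _ ⟨_, (hmax m).choose_spec.1⟩)
      (forall_mem_image.2 fun ξ hξ => ?_)) _
    obtain ⟨k, hk, hle⟩ := ReliefData.exists_corner_ge hfeas m.toLinearMap hξ
    have := hmaj ⟨k, B.finite_corners.mem_toFinset.2 hk⟩
    rw [← hm] at this
    exact hle.trans (sub_le_iff_le_add'.2 this)
  have hle (m') : ∑ k : K, p k * D.Q w k ≤ D.dualObj B μ w m' := hPval ▸ hweak P hPmem m'
  refine ⟨hint, hmax, ∑ k : K, p k * D.Q w k, IsGreatest.isLUB ⟨⟨P, hPmem, hPval⟩, ?_⟩,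
    ⟨m, hdual.antisymm (hle m)⟩, forall_mem_range.2 hle⟩
  exact forall_mem_image.2 fun P' hP' => (hweak P' hP' m).trans hdual

end
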